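/- Let $a:[0,1]\times[0,2\pi]\to\mathbb C$, and for $k\in\mathbb Z$, $x\in[0,1]$ let $\hat a_k(x)=\frac1{2\pi}\int_0^{2\pi}a(x,t)e^{-ikt}\,dt$. For $n\ge 0$ let $T_n(a)$ be the $(n+1)\times(n+1)$ matrix $$T_n(a)=\Big[\hat a_{j-i}\Big(\frac{i+j}{2n+2}\Big)\Big]_{i,j=0}^n .$$ Write $\|f\|_\infty=\sup_{[0,1]}|f|$ and $\|a\|_{\ast}=\sum_{k\in\mathbb Z}\|\hat a_k\|_\infty$. Let $0<\alpha\le 1$, and suppose that $a(x,\cdot)\in C^{1+\alpha}([0,2\pi])$ for every $x\in[0,1]$ and $a(\cdot,t)\in C^{1+\alpha}([0,1])$ for every $t\in[0,2\pi]$ (continuously differentiable with $\alpha$-Hölder derivative), that every $\hat a_k$ is continuously differentiable on $[0,1]$, and that $$\sum_{k\in\mathbb Z}|k|^{1+1/\alpha}\,\|\hat a_k\|_\infty<\infty\qquad\text{and}\qquad\sum_{k\in\mathbb Z}\|\partial_x\hat a_k\|_\infty<\infty .$$ Then, for every $p\in\mathbb N=\{0,1,2,\dots\}$, as $n\to\infty$,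 $$\begin{aligned}\operatorname{Tr}[T_n(a)^p]&=\frac{n+1}{2\pi}\int_0^1\!\int_0^{2\pi}a(x,t)^p\,dt\,dx+\frac1{4\pi}\int_0^{2\pi}a(0,t)^p\,dt-\frac1{4\pi}\int_0^{2\pi}a(1,t)^p\,dt\\&\quad-\sum_{\substack{h\in\mathbb Z^p\\ h_1+\cdots+h_p=0}}N(h)\Big[\prod_{j=1}^p\hat a_{h_j}(0)+\prod_{j=1}^p\hat a_{h_j}(1)\Big]+p\,\|a\|_{\ast}^{p-1}\,o(1),\end{aligned}$$ where $N(h)=\max\{0,h_1,h_1+h_2,\dots,h_1+\cdots+h_{p-1}\}$, the series over $h$ converges absolutely, and for each fixed $p$ the term $o(1)$ tends to $0$ as $n\to\infty$ (for $p=0$ the last two terms are $0$). -/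

import Mathlib

open Set Filter Topology MeasureTheory
open scoped NNReal BigOperators

noncomputable section

namespace KMS

/-- The `k`-th Fourier coefficient `x ↦ (1/2π) ∫₀^{2π} a(x,t) e^{-ikt} dt` of the symbol `a`. -/
def coeff (a : ℝ → ℝ → ℂ) (k : ℤ) (x : ℝ) : ℂ :=
  fourierCoeffOn Real.two_pi_pos (a x) k

/-- The matrix `T_n(a)`, with entries `â_{j-i}((i+j)/(2n+2))` for `0 ≤ i, j ≤ n`. -/
def T (a : ℝ → ℝ → ℂ) (n : ℕ) : Matrix (Fin (n + 1)) (Fin (n + 1)) ℂ :=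
  Matrix.of fun i j =>
    coeff a (((j : ℕ) : ℤ) - ((i : ℕ) : ℤ))
      ((((i : ℕ) : ℝ) + ((j : ℕ) : ℝ)) / (2 * (n : ℝ) + 2))

/-- The sup norm on `[0,1]`. -/
def supNorm (f : ℝ → ℂ) : ℝ := ⨆ x : Icc (0 : ℝ) 1, ‖f x‖

/-- `∑_k ‖â_k‖_∞`. -/
def tripleNorm (a : ℝ → ℝ → ℂ) : ℝ := ∑' k : ℤ, supNorm (coeff a k)

/-- `f ∈ C^{1+α}([u,v])`: continuously differentiable on `[u,v]` with `α`-Hölder derivative. -/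
def C1Holder (α : ℝ≥0) (f : ℝ → ℂ) (u v : ℝ) : Prop :=
  ContDiffOn ℝ 1 f (Icc u v) ∧
    ∃ C : ℝ≥0, HolderOnWith C α (derivWithin f (Icc u v)) (Icc u v)

/-- `N(h) = max {0, h₁, h₁+h₂, …, h₁+⋯+h_{p-1}}`. The term at `m` is the sum of the entries
before `m`, truncated at `0`; this does not change the maximum, since `0` belongs to the set. -/
def N {p : ℕ} (h : Fin p → ℤ) : ℕ :=
  Finset.univ.sup fun m : Fin p => (∑ j ∈ Finset.Iio m, h j).toNat

/-- The summand `N(h) (∏_j â_{h_j}(0) + ∏_j â_{h_j}(1))`. -/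
def edgeTerm (a : ℝ → ℝ → ℂ) {p : ℕ} (h : Fin p → ℤ) : ℂ :=
  (N h : ℂ) * ((∏ j, coeff a (h j) 0) + ∏ j, coeff a (h j) 1)

end KMS

end

/-!
Expanding the matrix product writes `Tr T_{m-1}(a)^p` as a sum over closed paths in
`{0, …, m - 1}`, that is, over zero-sum step tuples `h` and starting points `i`; the path stays in
the window exactly when `N (-h) ≤ i < m - N h`. Along it each factor `â_{h_j}` is evaluated at
`1 / m` times the midpoint of its step. Reversing a path and translating it back to its starting
point turns the midpoints relative to `i` into their negatives, so pairing `h` with its reversal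
cancels the first-order effect of the shifts: up to `o(1)` each pair contributes what it would with
every factor evaluated at `i / m`. There the trapezoid rule supplies the integral and half the
difference of the end-point values, and the starting points lost at the two ends of the window
supply `N h` times the boundary values. The sum over `h` passes to the limit by dominated
convergence: by a mean-value estimate the error of `h` is, uniformly in `m`, at most a constant
depending on `p` times `∏ⱼ w (h j)`, where `w k = (1 + |k|) ‖â_k‖ + ‖∂ₓ â_k‖` is summable.
-/

noncomputable section

namespace KMS

/-- The zero-sum tuples of integers: the step sequences of closed paths of length `p` in `ℤ`. -/
abbrev ZeroSum (p : ℕ) : Type := {h : Fin p → ℤ // ∑ j, h j = 0}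

namespace ZeroSum

variable {p : ℕ}

instance : Neg (ZeroSum p) := ⟨fun h => ⟨-h.1, by simp [h.2]⟩⟩

theorem coe_neg (h : ZeroSum p) : (-h).1 = -h.1 := rfl

/-- Reversal of the order of the steps of a closed path. -/
def rev : Equiv.Perm (ZeroSum p) :=
  (Fin.revPerm.arrowCongr (Equiv.refl ℤ)).subtypeEquiv fun h => by
    rw [← Equiv.sum_comp Fin.revPerm h]; rfl

theorem rev_apply (h : ZeroSum p) (j : Fin p) : (rev h).1 j = h.1 j.rev := rfl

end ZeroSum

theorem hasSum_prod_pow {R ι : Type*} [NormedCommRing R] [CompleteSpace R]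
    {f : ι → R} (hf : Summable fun k => ‖f k‖) (p : ℕ) :
    (Summable fun h : Fin p → ι => ‖∏ j, f (h j)‖) ∧
      HasSum (fun h : Fin p → ι => ∏ j, f (h j)) ((∑' k, f k) ^ p) := by
  induction p with
  | zero => exact ⟨(hasSum_fintype _).summable, by simp⟩
  | succ p ih =>
    have h_mul := hf.mul_norm ih.1
    have h_sum := tsum_mul_tsum_of_summable_norm hf ih.1 ▸ h_mul.of_norm.hasSum
    rw [ih.2.tsum_eq, ← pow_succ'] at h_sum
    rw [← (Fin.consEquiv fun _ => ι).summable_iff, ← (Fin.consEquiv fun _ => ι).hasSum_iff]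
    simpa [Function.comp_def, Fin.consEquiv, Fin.prod_univ_succ] using And.intro h_mul h_sum

section PartialSum

open Fin (partialSum)

variable {p : ℕ}

theorem partialSum_eq_sum_filter (h : Fin p → ℤ) (m : Fin (p + 1)) :
    partialSum h m = ∑ j with j.castSucc < m, h j :=
  List.sum_take_ofFn h m

theorem partialSum_cons_succ (k : ℤ) (h : Fin p → ℤ) (m : Fin (p + 1)) :
    partialSum (Fin.cons k h : Fin (p + 1) → ℤ) m.succ = k + partialSum h m := by
  simp [Fin.partialSum_succ']

theorem partialSum_last (h : Fin p → ℤ) : partialSum h (Fin.last p) = ∑ j, h j := by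
  simp [partialSum_eq_sum_filter, Fin.castSucc_lt_last]

theorem partialSum_neg (h : Fin p → ℤ) (m : Fin (p + 1)) :
    partialSum (-h) m = -partialSum h m := by
  simp [partialSum_eq_sum_filter]

theorem partialSum_rev (h : ZeroSum p) (m : Fin (p + 1)) :
    partialSum (ZeroSum.rev h).1 m = -partialSum h.1 m.rev := by
  induction m using Fin.induction with
  | zero => simp [partialSum_last, h.2]
  | succ j ih =>
    rw [Fin.partialSum_succ, ih, Fin.rev_castSucc, Fin.partialSum_succ, Fin.rev_succ,
      ZeroSum.rev_apply]
    ring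

theorem abs_partialSum_le {h : Fin p → ℤ} {m : Fin (p + 1)} {s : Finset (Fin p)}
    (hs : ∀ j, j.castSucc < m → j ∈ s) : |partialSum h m| ≤ ∑ j ∈ s, |h j| := by
  rw [partialSum_eq_sum_filter]
  refine (Finset.abs_sum_le_sum_abs _ _).trans
    (Finset.sum_le_sum_of_subset_of_nonneg (fun j hj => hs j ?_) fun _ _ _ => abs_nonneg _)
  exact (Finset.mem_filter.1 hj).2

theorem N_le_iff (h : ZeroSum p) {c : ℕ} :
    N h.1 ≤ c ↔ ∀ m, partialSum h.1 m ≤ c := by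
  rw [Fin.forall_fin_succ', partialSum_last, h.2, N, Finset.sup_le_iff]
  simp [partialSum_eq_sum_filter, Int.toNat_le, Finset.filter_gt_eq_Iio]

theorem N_rev (h : ZeroSum p) : N (ZeroSum.rev h).1 = N (-h).1 := by
  refine eq_of_forall_ge_iff fun c => ?_
  rw [N_le_iff, N_le_iff, ← Fin.revPerm.forall_congr_right]
  simp [partialSum_rev, ZeroSum.coe_neg, partialSum_neg]

theorem N_neg_rev (h : ZeroSum p) : N (-ZeroSum.rev h).1 = N h.1 := by
  rw [← neg_neg h.1]
  exact N_rev (-h)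

theorem N_le_sum_abs (h : ZeroSum p) : (N h.1 : ℤ) ≤ ∑ j, |h.1 j| := by
  lift ∑ j, |h.1 j| to ℕ using Finset.sum_nonneg fun _ _ => abs_nonneg _ with c hc
  rw [Nat.cast_le, N_le_iff, hc]
  exact fun m => (le_abs_self _).trans (abs_partialSum_le fun j _ => Finset.mem_univ j)

theorem mem_Ico_N_iff (h : ZeroSum p) {i m : ℕ} :
    i ∈ Finset.Ico (N (-h).1) (m - N h.1) ↔ ∀ q, (i : ℤ) + partialSum h.1 q ∈ Ico (0 : ℤ) m := by
  have le_N (h : ZeroSum p) (q) : partialSum h.1 q ≤ N h.1 := (N_le_iff h).1 le_rfl q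
  rw [Finset.mem_Ico]
  constructor
  · rintro ⟨h_left, h_right⟩ q
    have h_above := le_N h q
    have h_below : -partialSum h.1 q ≤ N (-h).1 := partialSum_neg h.1 q ▸ le_N (-h) q
    simp only [mem_Ico]
    omega
  · intro h_path
    have h_start := h_path 0
    simp only [Fin.partialSum_zero, mem_Ico] at h_path h_start
    refine ⟨(N_le_iff (-h)).2 fun q => ?_, ?_⟩
    · rw [ZeroSum.coe_neg, partialSum_neg]
      linarith [(h_path q).1]
    · have : N h.1 ≤ m - 1 - i := (N_le_iff h).2 fun q => by have := h_path q; omega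
      omega

/-- The midpoint of the `j`-th step of the path that starts at `0` and has steps `h`. An entry of
`T_n(a)` evaluates a Fourier coefficient of `a` at the rescaled midpoint of the corresponding
step. -/
def midpoint (h : Fin p → ℤ) (j : Fin p) : ℝ :=
  (partialSum h j.castSucc + partialSum h j.succ) / 2

theorem midpoint_rev (h : ZeroSum p) (j : Fin p) :
    midpoint (ZeroSum.rev h).1 j.rev = -midpoint h.1 j := by
  rw [midpoint, midpoint, partialSum_rev, partialSum_rev, Fin.rev_castSucc, Fin.rev_succ,
    Fin.rev_rev]
  push_cast
  ring

theorem abs_midpoint_le (h : ZeroSum p) (j : Fin p) :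
    |midpoint h.1 j| ≤ ∑ l ∈ Finset.univ.erase j, |(h.1 l : ℝ)| := by
  have abs_before_le (h : ZeroSum p) (j : Fin p) :
      |partialSum h.1 j.castSucc| ≤ ∑ l ∈ Finset.univ.erase j, |h.1 l| :=
    abs_partialSum_le fun l hl => by simpa using (Fin.castSucc_lt_castSucc_iff.1 hl).ne
  have abs_after_le : |partialSum h.1 j.succ| ≤ ∑ l ∈ Finset.univ.erase j, |h.1 l| := by
    calc |partialSum h.1 j.succ|
        = |partialSum (ZeroSum.rev h).1 j.rev.castSucc| := by
          rw [partialSum_rev, Fin.rev_castSucc, Fin.rev_rev, abs_neg]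
      _ ≤ ∑ l ∈ Finset.univ.erase j.rev, |(ZeroSum.rev h).1 l| := abs_before_le _ _
      _ = ∑ l ∈ Finset.univ.erase j, |h.1 l| :=
          Finset.sum_equiv Fin.revPerm (by simp [Fin.rev_eq_iff]) fun _ _ => rfl
  have h_sum : (|partialSum h.1 j.castSucc + partialSum h.1 j.succ| : ℤ) ≤
      2 * ∑ l ∈ Finset.univ.erase j, |h.1 l| := by
    linarith [abs_add_le (partialSum h.1 j.castSucc) (partialSum h.1 j.succ), abs_before_le h j]
  rw [midpoint, abs_div, abs_two, div_le_iff₀' two_pos]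
  exact_mod_cast h_sum

theorem add_midpoint_div_mem_Icc (h : ZeroSum p) {i m : ℕ}
    (hi : i ∈ Finset.Ico (N (-h).1) (m - N h.1)) (j : Fin p) :
    (i + midpoint h.1 j) / m ∈ Icc (0 : ℝ) 1 := by
  have h_before := (mem_Ico_N_iff h).1 hi j.castSucc
  have h_after := (mem_Ico_N_iff h).1 hi j.succ
  have hm : (0 : ℝ) < m := Nat.cast_pos.2 (by rw [Finset.mem_Ico] at hi; omega)
  rw [midpoint, mem_Icc, div_nonneg_iff, div_le_one hm]
  obtain ⟨h₀, h₁⟩ := h_before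
  obtain ⟨h₂, h₃⟩ := h_after
  have h₀' : (0 : ℝ) ≤ i + partialSum h.1 j.castSucc := mod_cast h₀
  have h₁' : (i + partialSum h.1 j.castSucc : ℝ) ≤ m := mod_cast h₁.le
  have h₂' : (0 : ℝ) ≤ i + partialSum h.1 j.succ := mod_cast h₂
  have h₃' : (i + partialSum h.1 j.succ : ℝ) ≤ m := mod_cast h₃.le
  exact ⟨.inl ⟨by linarith, hm.le⟩, by linarith⟩

end PartialSum

section MatrixPower

open Fin (partialSum)

variable {R : Type*} [CommSemiring R] {p : ℕ}

/-- The product of the values of `A` along the steps of the path that starts at `i` and has steps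
`h`. -/
def pathWeight (A : ℤ → ℤ → R) (i : ℤ) (h : Fin p → ℤ) : R :=
  ∏ j : Fin p, A (i + partialSum h j.castSucc) (i + partialSum h j.succ)

theorem pathWeight_cons (A : ℤ → ℤ → R) (i k : ℤ) (h : Fin p → ℤ) :
    pathWeight A i (Fin.cons k h : Fin (p + 1) → ℤ) = A i (i + k) * pathWeight A (i + k) h := by
  simp [pathWeight, Fin.prod_univ_succ, partialSum_cons_succ, add_assoc]

theorem hasSum_ite_head_eq {M ι : Type*} [DecidableEq ι] [AddCommMonoid M] [TopologicalSpace M]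
    {f : (Fin p → ι) → M} {s : M} (hf : HasSum f s) (k : ι) :
    HasSum (fun h : Fin (p + 1) → ι => if h 0 = k then f (Fin.tail h) else 0) s := by
  have h_inj : Function.Injective fun h : Fin p → ι => (Fin.cons k h : Fin (p + 1) → ι) :=
    Fin.cons_right_injective (α := fun _ => ι) k
  rw [← h_inj.hasSum_iff]
  · simpa [Function.comp_def] using hf
  · intro h h_range
    exact if_neg fun h_head => h_range ⟨Fin.tail h, by simp [← h_head]⟩

theorem hasSum_pow_apply [TopologicalSpace R] [IsTopologicalSemiring R] (A : ℤ → ℤ → R) (m p : ℕ)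
    (i k : Fin m) :
    HasSum (fun h : Fin p → ℤ =>
      if (∀ q, (i : ℤ) + partialSum h q ∈ Ico (0 : ℤ) m) ∧ (i : ℤ) + ∑ j, h j = k
      then pathWeight A i h else 0) (((Matrix.of fun i j : Fin m => A i j) ^ p) i k) := by
  induction p generalizing i with
  | zero => simp [pathWeight, Matrix.one_apply, Fin.ext_iff]
  | succ p ih =>
    rw [pow_succ', Matrix.mul_apply]
    refine (hasSum_sum fun l (_ : l ∈ Finset.univ) =>
      hasSum_ite_head_eq ((ih l).mul_left (A i l)) (l - i : ℤ)).congr_fun fun h => ?_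
    obtain ⟨k₀, h, rfl⟩ : ∃ k₀ h', h = (Fin.cons k₀ h' : Fin (p + 1) → ℤ) :=
      ⟨h 0, Fin.tail h, (Fin.cons_self_tail h).symm⟩
    simp only [Fin.forall_fin_succ (n := p + 1), Fin.partialSum_zero, partialSum_cons_succ,
      Fin.sum_cons, pathWeight_cons, Fin.cons_zero, Fin.tail_cons, ← add_assoc]
    by_cases h_mem : (i : ℤ) + k₀ ∈ Ico (0 : ℤ) m
    · obtain ⟨l, hl⟩ : ∃ l : Fin m, (l : ℤ) = i + k₀ :=
        ⟨⟨(i + k₀ : ℤ).toNat, by grind⟩, by grind⟩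
      have head_eq_iff (l' : Fin m) : k₀ = l' - i ↔ l = l' := by grind
      simp [head_eq_iff, ← hl]
    · rw [if_neg, Finset.sum_eq_zero]
      · intro l _
        exact if_neg (by grind)
      · rintro ⟨⟨-, h_path⟩, -⟩
        exact h_mem (by simpa using h_path 0)

theorem hasSum_trace_pow [TopologicalSpace R] [IsTopologicalSemiring R] (A : ℤ → ℤ → R) (m p : ℕ) :
    HasSum (fun h : ZeroSum p => ∑ i ∈ Finset.Ico (N (-h).1) (m - N h.1), pathWeight A i h.1)
      ((Matrix.of fun i j : Fin m => A i j) ^ p).trace := by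
  have h_sum := hasSum_sum fun i (_ : i ∈ Finset.univ) => hasSum_pow_apply A m p i i
  rw [← hasSum_subtype_iff_of_support_subset (s := {h : Fin p → ℤ | ∑ j, h j = 0})] at h_sum
  · refine HasSum.congr_fun h_sum fun h : ZeroSum p => ?_
    have h_end (i : ℤ) : i + ∑ j, h.1 j = i := by rw [h.2, add_zero]
    simp only [Function.comp_apply, h_end, and_true, ← mem_Ico_N_iff]
    rw [← Finset.sum_range fun i : ℕ =>
      if i ∈ Finset.Ico (N (-h).1) (m - N h.1) then pathWeight A i h.1 else 0, Finset.sum_ite_mem]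
    congr 1
    grind
  · refine Function.support_subset_iff'.2 fun h h_ne => Finset.sum_eq_zero fun i _ => if_neg ?_
    simpa using fun _ => h_ne

end MatrixPower

section Fourier

variable {τ : ℝ}

theorem prod_fourier {ι : Type*} (s : Finset ι) (k : ι → ℤ) (x : AddCircle τ) :
    ∏ j ∈ s, fourier (k j) x = fourier (∑ j ∈ s, k j) x := by
  classical
  induction s using Finset.induction_on with
  | empty => simp
  | insert j s hj ih => rw [Finset.prod_insert hj, Finset.sum_insert hj, ih, fourier_add]

variable [Fact (0 < τ)]

theorem ae_eq_tsum_fourier {f : AddCircle τ → ℂ} (hf : MemLp f 2 AddCircle.haarAddCircle)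
    (hs : Summable fun k => ‖fourierCoeff f k‖) :
    f =ᵐ[AddCircle.haarAddCircle] fun x => ∑' k, fourierCoeff f k * fourier k x := by
  have h_sum : Summable fun k => fourierCoeff f k • (fourier k : C(AddCircle τ, ℂ)) :=
    .of_norm (by simpa only [norm_smul, fourier_norm, mul_one] using hs)
  set g : C(AddCircle τ, ℂ) := ∑' k, fourierCoeff f k • fourier k
  have h_toLp : hf.toLp f = ContinuousMap.toLp (E := ℂ) 2 AddCircle.haarAddCircle ℂ g := by
    refine (hasSum_fourier_series_L2 (hf.toLp f)).unique ?_
    simp only [fourierCoeff_congr_ae hf.coeFn_toLp, fourierLp, ← map_smul]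
    exact (ContinuousMap.toLp (E := ℂ) 2 AddCircle.haarAddCircle ℂ).hasSum h_sum.hasSum
  have h_g : ⇑g = fun x => ∑' k, fourierCoeff f k * fourier k x :=
    funext fun x => ((ContinuousMap.evalCLM ℂ x).hasSum h_sum.hasSum).tsum_eq.symm
  rw [← h_g]
  exact hf.coeFn_toLp.symm.trans (h_toLp ▸ ContinuousMap.coeFn_toLp _ g)

theorem integral_fourier (k : ℤ) :
    ∫ x : AddCircle τ, fourier k x ∂AddCircle.haarAddCircle = if k = 0 then (1 : ℂ) else 0 := by
  have h_coeff := congrFun (fourierCoeff_fourier (T := τ) k) 0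
  simpa [fourierCoeff, Pi.single_apply, eq_comm] using h_coeff

theorem hasSum_integral_tsum_fourier_pow {c : ℤ → ℂ} (hc : Summable fun k => ‖c k‖) (p : ℕ) :
    HasSum (fun h : ZeroSum p => ∏ j, c (h.1 j))
      (∫ x : AddCircle τ, (∑' k, c k * fourier k x) ^ p ∂AddCircle.haarAddCircle) := by
  have norm_mul_fourier (z : ℂ) (k : ℤ) (x : AddCircle τ) : ‖z * fourier k x‖ = ‖z‖ := by
    rw [norm_mul, fourier_apply, Circle.norm_coe, mul_one]
  have h_pow (x : AddCircle τ) :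
      ∑' h : Fin p → ℤ, (∏ j, c (h j)) * fourier (∑ j, h j) x = (∑' k, c k * fourier k x) ^ p := by
    simp only [← prod_fourier, ← Finset.prod_mul_distrib]
    exact (hasSum_prod_pow (f := fun k => c k * fourier k x)
      (by simpa only [norm_mul_fourier] using hc) p).2.tsum_eq
  have h_int := hasSum_integral_of_summable_integral_norm (μ := AddCircle.haarAddCircle)
    (F := fun (h : Fin p → ℤ) (x : AddCircle τ) => (∏ j, c (h j)) * fourier (∑ j, h j) x)
    (fun h => ((map_continuous (fourier _)).integrable_of_hasCompactSupport
      (.of_compactSpace _)).const_mul _)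
    (by simpa only [norm_mul_fourier, integral_const, probReal_univ, one_smul]
      using (hasSum_prod_pow hc p).1)
  simp only [h_pow, integral_const_mul, integral_fourier] at h_int
  rw [← hasSum_subtype_iff_of_support_subset (s := {h : Fin p → ℤ | ∑ j, h j = 0})] at h_int
  · exact h_int.congr_fun fun h : ZeroSum p => by simp [h.2]
  · exact Function.support_subset_iff'.2 fun h h_ne => by simp [show ∑ j, h j ≠ 0 from h_ne]

theorem hasSum_intervalIntegral_pow {a b : ℝ} (hab : a < b) {f : ℝ → ℂ}
    (hf : MemLp f 2 (volume.restrict (Ioc a b)))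
    (hs : Summable fun k => ‖fourierCoeffOn hab f k‖) (p : ℕ) :
    HasSum (fun h : ZeroSum p => ((b - a : ℝ) : ℂ) * ∏ j, fourierCoeffOn hab f (h.1 j))
      (∫ t in a..b, f t ^ p) := by
  have := Fact.mk (sub_pos.2 hab)
  rw [← add_sub_cancel a b] at hf
  have h_series := ae_eq_tsum_fourier hf.memLp_liftIoc.haarAddCircle hs
  have h_sum := (hasSum_integral_tsum_fourier_pow (τ := b - a) hs p).mul_left ((b - a : ℝ) : ℂ)
  suffices h_eq : ∫ t in a..b, f t ^ p = ((b - a : ℝ) : ℂ) * ∫ x : AddCircle (b - a),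
      (∑' k, fourierCoeffOn hab f k * fourier k x) ^ p ∂AddCircle.haarAddCircle from h_eq ▸ h_sum
  calc ∫ t in a..b, f t ^ p
      = ∫ x, AddCircle.liftIoc (b - a) a (fun t => f t ^ p) x := by
        rw [AddCircle.integral_liftIoc_eq_intervalIntegral, add_sub_cancel]
    _ = ((b - a : ℝ) : ℂ) * ∫ x, AddCircle.liftIoc (b - a) a (fun t => f t ^ p) x
          ∂AddCircle.haarAddCircle := by
        rw [AddCircle.integral_haarAddCircle, ← Complex.real_smul,
          smul_inv_smul₀ (sub_pos.2 hab).ne']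
    _ = _ := congrArg _ <| integral_congr_ae <|
        h_series.mono fun x hx => congrArg (· ^ p) hx

end Fourier

section GridSums

variable {E V : Type*} [NormedAddCommGroup E] [NormedAddCommGroup V]

theorem tendsto_sum_range_of_norm_le_div {f : ℕ → ℕ → V}
    (hf : ∀ η > 0, ∀ᶠ m : ℕ in atTop, ∀ i < m, ‖f m i‖ ≤ η * (1 / m)) :
    Tendsto (fun m => ∑ i ∈ Finset.range m, f m i) atTop (𝓝 0) := by
  refine Metric.tendsto_nhds.2 fun η hη => ?_
  filter_upwards [hf (η / 2) (half_pos hη), eventually_gt_atTop 0] with m h_le hm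
  rw [dist_zero_right]
  calc ‖∑ i ∈ Finset.range m, f m i‖
      ≤ ∑ i ∈ Finset.range m, η / 2 * (1 / m) :=
        norm_sum_le_of_le _ fun i hi => h_le i (Finset.mem_range.1 hi)
    _ = η / 2 := by
        rw [Finset.sum_const, Finset.card_range, nsmul_eq_mul]
        field_simp
    _ < η := half_lt_self hη

variable [NormedSpace ℝ E] [NormedSpace ℝ V]

theorem exists_forall_norm_taylor_remainder_le {G : E → V} (hG : ContDiff ℝ 1 G) {K : Set E}
    (hK : IsCompact K) {η : ℝ} (hη : 0 < η) :
    ∃ δ > 0, ∀ x ∈ K, ∀ v, ‖v‖ < δ → ‖G (x + v) - G x - fderiv ℝ G x v‖ ≤ η * ‖v‖ := by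
  have h_cont : Continuous (fderiv ℝ G) := hG.continuous_fderiv one_ne_zero
  have h_unif := hK.uniformContinuousAt_of_continuousAt (fderiv ℝ G)
    (fun a _ => h_cont.continuousAt) (Metric.dist_mem_uniformity hη)
  obtain ⟨δ, hδ, h_close⟩ := Metric.mem_uniformity_dist.1 h_unif
  refine ⟨δ, hδ, fun x hx v hv => ?_⟩
  have h_mvt := (convex_ball x δ).norm_image_sub_le_of_norm_fderiv_le' (𝕜 := ℝ) (f := G)
    (φ := fderiv ℝ G x) (C := η) (x := x) (y := x + v)
    (fun y _ => (hG.differentiable one_ne_zero).differentiableAt)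
    (fun y hy => by
      rw [← dist_eq_norm, dist_comm]
      exact (h_close (by rwa [dist_comm]) hx).le)
    (Metric.mem_ball_self hδ) (by simpa using hv)
  simpa using h_mvt

theorem exists_forall_norm_second_difference_le {G : E → V} (hG : ContDiff ℝ 1 G) {K : Set E}
    (hK : IsCompact K) {η : ℝ} (hη : 0 < η) :
    ∃ δ > 0, ∀ x ∈ K, ∀ r < δ, ∀ u v, ‖u‖ ≤ r → ‖v‖ ≤ r → ‖u + v‖ ≤ r →
      ‖G (x + u) + G (x + v) - G x - G (x + (u + v))‖ ≤ η * r := by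
  obtain ⟨δ, hδ, h_taylor⟩ :=
    exists_forall_norm_taylor_remainder_le hG hK (η := η / 3) (by positivity)
  refine ⟨δ, hδ, fun x hx r hr u v hu hv huv => ?_⟩
  set R : E → V := fun w => G (x + w) - G x - fderiv ℝ G x w
  have norm_R_le {w : E} (hw : ‖w‖ ≤ r) : ‖R w‖ ≤ η / 3 * r :=
    (h_taylor x hx w (hw.trans_lt hr)).trans (by gcongr)
  calc ‖G (x + u) + G (x + v) - G x - G (x + (u + v))‖
      = ‖R u + R v - R (u + v)‖ := by
        congr 1
        simp only [R, map_add]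
        abel
    _ ≤ ‖R u‖ + ‖R v‖ + ‖R (u + v)‖ :=
        (norm_sub_le _ _).trans (add_le_add_left (norm_add_le _ _) _)
    _ ≤ η * r := by linarith [norm_R_le hu, norm_R_le hv, norm_R_le huv]

theorem natCast_div_mem_Icc {i m : ℕ} (hi : i ≤ m) : (i / m : ℝ) ∈ Icc (0 : ℝ) 1 :=
  ⟨by positivity, div_le_one_of_le₀ (mod_cast hi) (by positivity)⟩

theorem nsmul_integral_eq_sum_integral_cells {F : ℝ → V} (hF : IntervalIntegrable F volume 0 1)
    (m : ℕ) :
    m • ∫ x in (0 : ℝ)..1, F x = ∑ i ∈ Finset.range m, ∫ s in (0 : ℝ)..1, F (i / m + s / m) := by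
  rcases m.eq_zero_or_pos with rfl | hm
  · simp
  have h_adj := intervalIntegral.sum_integral_adjacent_intervals (f := F) (μ := volume)
    (a := fun i : ℕ => (i / m : ℝ)) (n := m) fun i hi => by
      refine hF.mono_set (uIcc_subset_uIcc ?_ ?_) <;> rw [uIcc_of_le zero_le_one]
      exacts [natCast_div_mem_Icc hi.le, natCast_div_mem_Icc hi]
  have h_cell (i : ℕ) : ∫ s in (0 : ℝ)..1, F (i / m + s / m) =
      (m : ℝ) • ∫ x in (i / m : ℝ)..((i + 1 : ℕ) / m : ℝ), F x := by
    rw [intervalIntegral.integral_comp_add_div F (by positivity)]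
    simp [add_div]
  simp only [h_cell, ← Finset.smul_sum, h_adj]
  simp [hm.ne', Nat.cast_smul_eq_nsmul]

theorem two_nsmul_sum_range_sub_integral [CompleteSpace V] {F : ℝ → V} (hF : Continuous F) {m : ℕ}
    (hm : m ≠ 0) :
    2 • (∑ i ∈ Finset.range m, F (i / m) - m • ∫ x in (0 : ℝ)..1, F x) =
      F 0 - F 1 - ∑ i ∈ Finset.range m, ∫ s in (0 : ℝ)..1,
        (F (i / m + s / m) + F (i / m + (1 - s) / m) - F (i / m) - F ((i + 1 : ℕ) / m)) := by
  have h_reflect (i : ℕ) : ∫ s in (0 : ℝ)..1, F (i / m + (1 - s) / m) =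
      ∫ s in (0 : ℝ)..1, F (i / m + s / m) := by
    simpa using intervalIntegral.integral_comp_sub_left (a := 0) (b := 1)
      (fun s => F (i / m + s / m)) 1
  have h_cell (i : ℕ) : ∫ s in (0 : ℝ)..1,
        (F (i / m + s / m) + F (i / m + (1 - s) / m) - F (i / m) - F ((i + 1 : ℕ) / m)) =
      2 • (∫ s in (0 : ℝ)..1, F (i / m + s / m)) - 2 • F (i / m) -
        (F ((i + 1 : ℕ) / m) - F (i / m)) := by
    rw [intervalIntegral.integral_sub, intervalIntegral.integral_sub, intervalIntegral.integral_add,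
      h_reflect]
    · simp only [intervalIntegral.integral_const, sub_zero, one_smul]
      abel
    all_goals exact Continuous.intervalIntegrable (by fun_prop) 0 1
  have h_telescope := Finset.sum_range_sub (fun i : ℕ => F (i / m)) m
  rw [div_self (by positivity), Nat.cast_zero, zero_div] at h_telescope
  simp only [h_cell, Finset.sum_sub_distrib, h_telescope, ← Finset.smul_sum, smul_sub,
    ← nsmul_integral_eq_sum_integral_cells (hF.intervalIntegrable 0 1)]
  abel

theorem tendsto_two_nsmul_sum_range_sub_integral [CompleteSpace V] {F : ℝ → V}
    (hF : ContDiff ℝ 1 F) :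
    Tendsto (fun m : ℕ => 2 • (∑ i ∈ Finset.range m, F (i / m) - m • ∫ x in (0 : ℝ)..1, F x))
      atTop (𝓝 (F 0 - F 1)) := by
  suffices h_err : Tendsto (fun m : ℕ => ∑ i ∈ Finset.range m, ∫ s in (0 : ℝ)..1,
      (F (i / m + s / m) + F (i / m + (1 - s) / m) - F (i / m) - F ((i + 1 : ℕ) / m))) atTop
      (𝓝 0) by
    have h_lim := h_err.const_sub (F 0 - F 1)
    rw [sub_zero] at h_lim
    refine h_lim.congr' ?_
    filter_upwards [eventually_ne_atTop 0] with m hm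
    exact (two_nsmul_sum_range_sub_integral hF.continuous hm).symm
  refine tendsto_sum_range_of_norm_le_div fun η hη => ?_
  obtain ⟨δ, hδ, h_diff⟩ := exists_forall_norm_second_difference_le hF
    (isCompact_Icc (a := (0 : ℝ)) (b := 1)) hη
  filter_upwards [tendsto_one_div_atTop_nhds_zero_nat.eventually (gt_mem_nhds hδ)] with m hm i hi
  have norm_div_le {t : ℝ} (ht : t ∈ Icc (0 : ℝ) 1) : ‖t / m‖ ≤ 1 / m := by
    rw [Real.norm_of_nonneg (div_nonneg ht.1 m.cast_nonneg)]
    gcongr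
    exact ht.2
  have h_bound (s) (hs : s ∈ uIoc (0 : ℝ) 1) :
      ‖F (i / m + s / m) + F (i / m + (1 - s) / m) - F (i / m) - F ((i + 1 : ℕ) / m)‖ ≤
        η * (1 / m) := by
    rw [uIoc_of_le zero_le_one] at hs
    have h_succ : ((i + 1 : ℕ) / m : ℝ) = i / m + (s / m + (1 - s) / m) := by
      push_cast
      ring
    rw [h_succ]
    refine h_diff _ (natCast_div_mem_Icc hi.le) _ hm _ _ (norm_div_le ⟨hs.1.le, hs.2⟩)
      (norm_div_le ⟨by linarith [hs.2], by linarith [hs.1]⟩) ?_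
    rw [← add_div, add_sub_cancel]
    exact norm_div_le (right_mem_Icc.2 zero_le_one)
  simpa using intervalIntegral.norm_integral_le_of_norm_le_const h_bound

theorem tendsto_sum_range_symm_difference {G : ℝ × ℝ → V} (hG : ContDiff ℝ 1 G) :
    Tendsto (fun m : ℕ => ∑ i ∈ Finset.range m,
      (G (i / m, 1 / m) + G (i / m, -(1 / m)) - 2 • G (i / m, 0))) atTop (𝓝 0) := by
  refine tendsto_sum_range_of_norm_le_div fun η hη => ?_
  obtain ⟨δ, hδ, h_diff⟩ := exists_forall_norm_second_difference_le hG
    ((isCompact_Icc (a := (0 : ℝ)) (b := 1)).prod (isCompact_singleton (x := (0 : ℝ)))) hη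
  filter_upwards [tendsto_one_div_atTop_nhds_zero_nat.eventually (gt_mem_nhds hδ)] with m hm i hi
  simpa [sub_sub, two_nsmul] using h_diff (i / m, 0) ⟨natCast_div_mem_Icc hi.le, rfl⟩ (1 / m) hm
    (0, 1 / m) (0, -(1 / m)) (by simp) (by simp) (by simp)

theorem tendsto_sum_Ico_sub_sum_range {M : Type*} [AddCommGroup M] [TopologicalSpace M]
    [IsTopologicalAddGroup M] {f : ℕ → ℕ → M} {a b : M}
    (ha : ∀ i, Tendsto (fun m => f m i) atTop (𝓝 a))
    (hb : ∀ i, Tendsto (fun m => f m (m - 1 - i)) atTop (𝓝 b)) (k l : ℕ) :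
    Tendsto (fun m => ∑ i ∈ Finset.Ico k (m - l), f m i - ∑ i ∈ Finset.range m, f m i) atTop
      (𝓝 (-(k • a + l • b))) := by
  have h_lim := (tendsto_finsetSum (Finset.range k) fun i _ => ha i).add
    (tendsto_finsetSum (Finset.range l) fun i _ => hb i)
  simp only [Finset.sum_const, Finset.card_range] at h_lim
  refine h_lim.neg.congr' ?_
  filter_upwards [eventually_ge_atTop (k + l + 1)] with m hm
  have h_right : ∑ i ∈ Finset.range l, f m (m - 1 - i) = ∑ i ∈ Finset.Ico (m - l) m, f m i := by
    rw [Finset.range_eq_Ico, Finset.sum_Ico_reflect _ _ (by omega), Nat.sub_zero,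
      Nat.sub_add_cancel (by omega)]
  rw [h_right, Finset.range_eq_Ico, Finset.range_eq_Ico,
    ← Finset.sum_Ico_consecutive _ (Nat.zero_le k) (by omega : k ≤ m),
    ← Finset.sum_Ico_consecutive _ (by omega : k ≤ m - l) (Nat.sub_le m l)]
  abel

theorem tendsto_natCast_sub_div_atTop (i : ℕ) :
    Tendsto (fun m : ℕ => (((m - 1 - i : ℕ) : ℝ) / m)) atTop (𝓝 1) := by
  have h_lim := (tendsto_const_div_atTop_nhds_zero_nat (i + 1 : ℝ)).const_sub 1
  rw [sub_zero] at h_lim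
  refine h_lim.congr' ?_
  filter_upwards [eventually_gt_atTop i] with m hm
  have hm' : (m : ℝ) ≠ 0 := mod_cast (i.zero_le.trans_lt hm).ne'
  rw [Nat.sub_sub, Nat.cast_sub (by omega), sub_div, div_self hm']
  push_cast
  ring

theorem tendsto_symm_sum_Ico_sub_integral [CompleteSpace V] {G : ℝ × ℝ → V} (hG : ContDiff ℝ 1 G)
    (k l : ℕ) :
    Tendsto (fun m : ℕ =>
      (∑ i ∈ Finset.Ico k (m - l), G (i / m, 1 / m) - m • ∫ x in (0 : ℝ)..1, G (x, 0)) +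
        (∑ i ∈ Finset.Ico l (m - k), G (i / m, -(1 / m)) - m • ∫ x in (0 : ℝ)..1, G (x, 0)))
      atTop (𝓝 (G (0, 0) - G (1, 0) - (k + l) • (G (0, 0) + G (1, 0)))) := by
  have h_boundary {e : ℕ → ℝ} (he : Tendsto e atTop (𝓝 0)) (k l : ℕ) :=
    tendsto_sum_Ico_sub_sum_range (f := fun m i => G (i / m, e m))
      (fun i => (hG.continuous.tendsto (0, 0)).comp
        ((tendsto_const_div_atTop_nhds_zero_nat (i : ℝ)).prodMk_nhds he))
      (fun i => (hG.continuous.tendsto (1, 0)).comp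
        ((tendsto_natCast_sub_div_atTop i).prodMk_nhds he)) k l
  have h_inv : Tendsto (fun m : ℕ => (1 / m : ℝ)) atTop (𝓝 0) := tendsto_one_div_atTop_nhds_zero_nat
  have h_grid := tendsto_two_nsmul_sum_range_sub_integral (F := fun x => G (x, 0)) (by fun_prop)
  have h_neg_inv : Tendsto (fun m : ℕ => -(1 / m : ℝ)) atTop (𝓝 0) := by simpa using h_inv.neg
  have h_lim := ((h_boundary h_inv k l).add (h_boundary h_neg_inv l k)).add
    ((tendsto_sum_range_symm_difference hG).add h_grid)
  convert h_lim using 2 with m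
  · simp only [Finset.sum_sub_distrib, Finset.sum_add_distrib, smul_sub, two_nsmul]
    abel
  · simp only [add_smul, smul_add]
    abel

end GridSums

section UnitInterval

variable {V : Type*} [NormedAddCommGroup V] [NormedSpace ℝ V] [CompleteSpace V]

theorem exists_contDiff_eqOn_Icc {f : ℝ → V} {u v : ℝ} (huv : u < v)
    (hf : ContDiffOn ℝ 1 f (Icc u v)) : ∃ g : ℝ → V, ContDiff ℝ 1 g ∧ EqOn f g (Icc u v) := by
  set f' : ℝ → V := IccExtend huv.le ((Icc u v).domRestrict (derivWithin f (Icc u v))) with hf'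
  have h_cont : Continuous f' := Continuous.Icc_extend' <|
    continuousOn_iff_continuous_domRestrict.1 <|
      hf.continuousOn_derivWithin (uniqueDiffOn_Icc huv) le_rfl
  have h_deriv (x : ℝ) : HasDerivAt (fun x => f u + ∫ t in u..x, f' t) (f' x) x :=
    (h_cont.integral_hasStrictDerivAt u x).hasDerivAt.const_add _
  refine ⟨fun x => f u + ∫ t in u..x, f' t, contDiff_one_iff_deriv.2
    ⟨fun x => (h_deriv x).differentiableAt, ?_⟩, fun x hx => ?_⟩
  · rwa [funext fun x => (h_deriv x).deriv]
  · have h_ftc := intervalIntegral.integral_eq_sub_of_hasDeriv_right_of_le (f := f) (f' := f') hx.1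
      (hf.continuousOn.mono (Icc_subset_Icc_right hx.2)) (fun y hy => by
        have hy' : y ∈ Ioo u v := ⟨hy.1, hy.2.trans_le hx.2⟩
        rw [hf', IccExtend_of_mem _ _ (Ioo_subset_Icc_self hy')]
        exact ((hf.differentiableOn one_ne_zero y
          (Ioo_subset_Icc_self hy')).hasDerivWithinAt.hasDerivAt
            (Icc_mem_nhds hy'.1 hy'.2)).hasDerivWithinAt)
      (h_cont.intervalIntegrable _ _)
    simp [h_ftc]

theorem natCast_div_add_div_mem_Icc {i m : ℕ} (hi : i < m) {s : ℝ} (hs : s ∈ Icc (0 : ℝ) 1) :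
    (i / m + s / m : ℝ) ∈ Icc (0 : ℝ) 1 := by
  obtain ⟨hs₀, hs₁⟩ := hs
  refine ⟨by positivity, ?_⟩
  rw [← add_div]
  refine div_le_one_of_le₀ ?_ m.cast_nonneg
  have hi' : (i + 1 : ℝ) ≤ m := mod_cast hi
  linarith

theorem norm_sub_integral_le_of_forall_norm_sub_le {g : ℝ → V}
    (hg : IntervalIntegrable g volume 0 1) {w : V} {C : ℝ}
    (h : ∀ s ∈ Icc (0 : ℝ) 1, ‖w - g s‖ ≤ C) : ‖w - ∫ s in (0 : ℝ)..1, g s‖ ≤ C := by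
  have h_int : w - ∫ s in (0 : ℝ)..1, g s = ∫ s in (0 : ℝ)..1, (w - g s) := by
    simp [intervalIntegral.integral_sub intervalIntegrable_const hg]
  rw [h_int]
  simpa using intervalIntegral.norm_integral_le_of_norm_le_const fun s hs =>
    h s (uIoc_subset_uIcc.trans_eq (uIcc_of_le zero_le_one) hs)

theorem norm_sum_Ico_sub_sum_range_le {M : Type*} [SeminormedAddCommGroup M] {w c : ℕ → M}
    {k l m : ℕ} {Q D : ℝ} (hQ : 0 ≤ Q) (hD : 0 ≤ D) (hc : ∀ i ∈ Finset.range m, ‖c i‖ ≤ Q)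
    (hw : ∀ i ∈ Finset.Ico k (m - l), ‖w i - c i‖ ≤ D / m) :
    ‖∑ i ∈ Finset.Ico k (m - l), w i - ∑ i ∈ Finset.range m, c i‖ ≤ (k + l) * Q + D := by
  have h_sub : Finset.Ico k (m - l) ⊆ Finset.range m := fun i hi =>
    Finset.mem_range.2 ((Finset.mem_Ico.1 hi).2.trans_le (m.sub_le l))
  have h_outer : ((m - (m - l - k) : ℕ) : ℝ) ≤ k + l :=
    mod_cast (by omega : m - (m - l - k) ≤ k + l)
  have h_inner : ((m - l - k : ℕ) : ℝ) ≤ m := mod_cast (by omega : m - l - k ≤ m)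
  calc ‖∑ i ∈ Finset.Ico k (m - l), w i - ∑ i ∈ Finset.range m, c i‖
      = ‖∑ i ∈ Finset.Ico k (m - l), (w i - c i) -
          ∑ i ∈ Finset.range m \ Finset.Ico k (m - l), c i‖ := by
        rw [← Finset.sum_sdiff h_sub, Finset.sum_sub_distrib]
        congr 1
        abel
    _ ≤ ∑ _i ∈ Finset.Ico k (m - l), D / m + ∑ _i ∈ Finset.range m \ Finset.Ico k (m - l), Q :=
        (norm_sub_le _ _).trans (add_le_add (norm_sum_le_of_le _ hw)
          (norm_sum_le_of_le _ fun i hi => hc i (Finset.mem_sdiff.1 hi).1))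
    _ = (m - (m - l - k) : ℕ) * Q + D * ((m - l - k : ℕ) / m) := by
        rw [Finset.sum_const, Finset.sum_const, Finset.card_sdiff_of_subset h_sub,
          Nat.card_Ico, Finset.card_range, nsmul_eq_mul, nsmul_eq_mul]
        ring
    _ ≤ (k + l) * Q + D := add_le_add (mul_le_mul_of_nonneg_right h_outer hQ)
        (mul_le_of_le_one_right hD (div_le_one_of_le₀ h_inner m.cast_nonneg))

theorem norm_sum_Ico_sub_nsmul_integral_le {F : ℝ → V} (hF : ContinuousOn F (Icc 0 1))
    {w : ℕ → V} {k l m : ℕ} {Q D : ℝ} (hQ : ∀ x ∈ Icc (0 : ℝ) 1, ‖F x‖ ≤ Q) (hD : 0 ≤ D)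
    (hw : ∀ i ∈ Finset.Ico k (m - l), ∀ s ∈ Icc (0 : ℝ) 1, ‖w i - F (i / m + s / m)‖ ≤ D / m) :
    ‖∑ i ∈ Finset.Ico k (m - l), w i - m • ∫ x in (0 : ℝ)..1, F x‖ ≤ (k + l) * Q + D := by
  have h_cell {i} (hi : i < m) :
      IntervalIntegrable (fun s : ℝ => F (i / m + s / m)) volume 0 1 :=
    (hF.comp (by fun_prop) fun s hs =>
      natCast_div_add_div_mem_Icc hi hs).intervalIntegrable_of_Icc zero_le_one
  rw [nsmul_integral_eq_sum_integral_cells (hF.intervalIntegrable_of_Icc zero_le_one)]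
  refine norm_sum_Ico_sub_sum_range_le ((norm_nonneg _).trans (hQ 0 (left_mem_Icc.2 zero_le_one)))
    hD (fun i hi => ?_) fun i hi => ?_
  · simpa using norm_sub_integral_le_of_forall_norm_sub_le (w := 0)
      (h_cell (Finset.mem_range.1 hi)) fun s hs => by
        simpa using hQ _ (natCast_div_add_div_mem_Icc (Finset.mem_range.1 hi) hs)
  · exact norm_sub_integral_le_of_forall_norm_sub_le
      (h_cell ((Finset.mem_Ico.1 hi).2.trans_le (m.sub_le l))) (hw i hi)

end UnitInterval

section SupNorm

variable {f : ℝ → ℂ}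

theorem supNorm_nonneg (f : ℝ → ℂ) : 0 ≤ supNorm f := Real.iSup_nonneg fun _ => norm_nonneg _

theorem norm_le_supNorm (hf : ContinuousOn f (Icc 0 1)) {x : ℝ} (hx : x ∈ Icc (0 : ℝ) 1) :
    ‖f x‖ ≤ supNorm f := by
  obtain ⟨C, hC⟩ := isCompact_Icc.exists_bound_of_continuousOn hf
  exact le_ciSup (f := fun x : Icc (0 : ℝ) 1 => ‖f x‖)
    ⟨C, forall_mem_range.2 fun y => hC y y.2⟩ ⟨x, hx⟩

theorem norm_sub_le_supNorm_derivWithin (hf : ContDiffOn ℝ 1 f (Icc 0 1)) {x y : ℝ}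
    (hx : x ∈ Icc (0 : ℝ) 1) (hy : y ∈ Icc (0 : ℝ) 1) :
    ‖f y - f x‖ ≤ supNorm (derivWithin f (Icc 0 1)) * |y - x| :=
  (convex_Icc (0 : ℝ) 1).norm_image_sub_le_of_norm_derivWithin_le
    (hf.differentiableOn one_ne_zero)
    (fun _ hz => norm_le_supNorm
      (hf.continuousOn_derivWithin (uniqueDiffOn_Icc zero_lt_one) le_rfl) hz) hx hy

end SupNorm

section ShiftedProducts

theorem norm_prod_sub_prod_le {R ι : Type*} [NormedCommRing R] [NormOneClass R] [DecidableEq ι]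
    (s : Finset ι) {u v : ι → R} {A θ : ι → ℝ} (hu : ∀ j, ‖u j‖ ≤ A j) (hv : ∀ j, ‖v j‖ ≤ A j)
    (hθ : ∀ j, ‖u j - v j‖ ≤ θ j) :
    ‖∏ j ∈ s, u j - ∏ j ∈ s, v j‖ ≤ ∑ j ∈ s, θ j * ∏ l ∈ s.erase j, A l := by
  induction s using Finset.induction_on with
  | empty => simp
  | insert i s hi ih =>
    have h_erase : ∑ j ∈ s, θ j * ∏ l ∈ (insert i s).erase j, A l =
        A i * ∑ j ∈ s, θ j * ∏ l ∈ s.erase j, A l := by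
      rw [Finset.mul_sum]
      refine Finset.sum_congr rfl fun j hj => ?_
      rw [Finset.erase_insert_of_ne (ne_of_mem_of_not_mem hj hi).symm,
        Finset.prod_insert fun h => hi (Finset.mem_of_mem_erase h)]
      ring
    have h_prod : ‖∏ j ∈ s, v j‖ ≤ ∏ j ∈ s, A j :=
      (s.norm_prod_le v).trans (Finset.prod_le_prod (fun _ _ => norm_nonneg _) fun j _ => hv j)
    rw [Finset.prod_insert hi, Finset.prod_insert hi, Finset.sum_insert hi, Finset.erase_insert hi,
      h_erase]
    calc ‖u i * ∏ j ∈ s, u j - v i * ∏ j ∈ s, v j‖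
        = ‖(u i - v i) * ∏ j ∈ s, v j + u i * (∏ j ∈ s, u j - ∏ j ∈ s, v j)‖ := by
          congr 1
          ring
      _ ≤ ‖u i - v i‖ * ‖∏ j ∈ s, v j‖ + ‖u i‖ * ‖∏ j ∈ s, u j - ∏ j ∈ s, v j‖ :=
          (norm_add_le _ _).trans (add_le_add (norm_mul_le _ _) (norm_mul_le _ _))
      _ ≤ θ i * ∏ j ∈ s, A j + A i * ∑ j ∈ s, θ j * ∏ l ∈ s.erase j, A l := by
          have := (norm_nonneg _).trans (hθ i)
          have := (norm_nonneg _).trans (hu i)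
          gcongr
          exacts [hθ i, hu i]

variable {ι : Type*} [Fintype ι] {f : ι → ℝ → ℂ}

theorem norm_prod_le_prod_supNorm (hf : ∀ j, ContinuousOn (f j) (Icc 0 1)) {x : ℝ}
    (hx : x ∈ Icc (0 : ℝ) 1) : ‖∏ j, f j x‖ ≤ ∏ j, supNorm (f j) := by
  rw [norm_prod]
  exact Finset.prod_le_prod (fun _ _ => norm_nonneg _) fun j _ => norm_le_supNorm (hf j) hx

theorem norm_sum_Ico_prod_sub_nsmul_integral_le [DecidableEq ι]
    (hf : ∀ j, ContDiffOn ℝ 1 (f j) (Icc 0 1)) {σ : ι → ℝ} {k l m : ℕ}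
    (hσ : ∀ i ∈ Finset.Ico k (m - l), ∀ j, (i + σ j) / m ∈ Icc (0 : ℝ) 1) :
    ‖∑ i ∈ Finset.Ico k (m - l), ∏ j, f j ((i + σ j) / m) -
        m • ∫ x in (0 : ℝ)..1, ∏ j, f j x‖ ≤
      (k + l) * ∏ j, supNorm (f j) +
        ∑ j, supNorm (derivWithin (f j) (Icc 0 1)) * (1 + |σ j|) *
          ∏ q ∈ Finset.univ.erase j, supNorm (f q) := by
  have h_cont (j) : ContinuousOn (f j) (Icc 0 1) := (hf j).continuousOn
  refine norm_sum_Ico_sub_nsmul_integral_le (F := fun x => ∏ j, f j x)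
    (continuousOn_finsetProd _ fun j _ => h_cont j)
    (fun x hx => norm_prod_le_prod_supNorm h_cont hx)
    (Finset.sum_nonneg fun j _ => mul_nonneg (mul_nonneg (supNorm_nonneg _) (by positivity))
      (Finset.prod_nonneg fun _ _ => supNorm_nonneg _)) fun i hi s hs => ?_
  have h_cell : (i / m + s / m : ℝ) ∈ Icc (0 : ℝ) 1 :=
    natCast_div_add_div_mem_Icc ((Finset.mem_Ico.1 hi).2.trans_le (m.sub_le l)) hs
  have h_factor (j) : ‖f j ((i + σ j) / m) - f j (i / m + s / m)‖ ≤
      supNorm (derivWithin (f j) (Icc 0 1)) * ((1 + |σ j|) / m) := by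
    refine (norm_sub_le_supNorm_derivWithin (hf j) h_cell (hσ i hi j)).trans
      (mul_le_mul_of_nonneg_left ?_ (supNorm_nonneg _))
    rw [← add_div, ← sub_div, abs_div, Nat.abs_cast, add_sub_add_left_eq_sub]
    gcongr
    calc |σ j - s| ≤ |σ j| + |s| := abs_sub _ _
      _ ≤ 1 + |σ j| := by rw [abs_of_nonneg hs.1]; linarith [hs.2]
  refine (norm_prod_sub_prod_le _ (fun j => norm_le_supNorm (h_cont j) (hσ i hi j))
    (fun j => norm_le_supNorm (h_cont j) h_cell) h_factor).trans_eq ?_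
  rw [Finset.sum_div]
  exact Finset.sum_congr rfl fun j _ => by ring

theorem tendsto_symm_sum_Ico_prod_sub_integral (hf : ∀ j, ContDiffOn ℝ 1 (f j) (Icc 0 1))
    {σ : ι → ℝ} {k l : ℕ}
    (hσ : ∀ m : ℕ, ∀ i ∈ Finset.Ico k (m - l), ∀ j, (i + σ j) / m ∈ Icc (0 : ℝ) 1)
    (hσ' : ∀ m : ℕ, ∀ i ∈ Finset.Ico l (m - k), ∀ j, (i + -σ j) / m ∈ Icc (0 : ℝ) 1) :
    Tendsto (fun m : ℕ =>
      (∑ i ∈ Finset.Ico k (m - l), ∏ j, f j ((i + σ j) / m) -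
          m • ∫ x in (0 : ℝ)..1, ∏ j, f j x) +
        (∑ i ∈ Finset.Ico l (m - k), ∏ j, f j ((i + -σ j) / m) -
          m • ∫ x in (0 : ℝ)..1, ∏ j, f j x)) atTop
      (𝓝 (∏ j, f j 0 - ∏ j, f j 1 - (k + l) • (∏ j, f j 0 + ∏ j, f j 1))) := by
  choose g hg h_eq using fun j => exists_contDiff_eqOn_Icc zero_lt_one (hf j)
  have h_prod {y : ι → ℝ} (hy : ∀ j, y j ∈ Icc (0 : ℝ) 1) : ∏ j, f j (y j) = ∏ j, g j (y j) :=
    Finset.prod_congr rfl fun j _ => h_eq j (hy j)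
  have h_int : ∫ x in (0 : ℝ)..1, ∏ j, f j x = ∫ x in (0 : ℝ)..1, ∏ j, g j x :=
    intervalIntegral.integral_congr fun x hx =>
      h_prod fun _ => by rwa [uIcc_of_le zero_le_one] at hx
  have hG : ContDiff ℝ 1 fun z : ℝ × ℝ => ∏ j, g j (z.1 + z.2 * σ j) :=
    contDiff_prod fun j _ => (hg j).comp (by fun_prop)
  have h_lim := tendsto_symm_sum_Ico_sub_integral hG k l
  simp only [zero_mul, add_zero] at h_lim
  rw [h_prod fun _ => left_mem_Icc.2 zero_le_one, h_prod fun _ => right_mem_Icc.2 zero_le_one,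
    h_int]
  refine h_lim.congr fun m => ?_
  congr 2 <;> refine Finset.sum_congr rfl fun i hi => ?_
  · rw [h_prod (hσ m i hi)]
    exact Finset.prod_congr rfl fun j _ => by ring_nf
  · rw [h_prod (hσ' m i hi)]
    exact Finset.prod_congr rfl fun j _ => by ring_nf

end ShiftedProducts

section Symbol

variable {a : ℝ → ℝ → ℂ} {p : ℕ}

/-- The contribution to `Tr T_{m-1}(a)^p` of the closed paths with steps `h`, minus its leading
part. -/
def remainder (a : ℝ → ℝ → ℂ) (m : ℕ) {p : ℕ} (h : Fin p → ℤ) : ℂ :=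
  ∑ i ∈ Finset.Ico (N (-h)) (m - N h), ∏ j, coeff a (h j) ((i + midpoint h j) / m) -
    m • ∫ x in (0 : ℝ)..1, ∏ j, coeff a (h j) x

/-- The contribution of the closed paths with steps `h` to the constant term of the asymptotic
expansion of the trace. -/
def secondOrderTerm (a : ℝ → ℝ → ℂ) {p : ℕ} (h : Fin p → ℤ) : ℂ :=
  (∏ j, coeff a (h j) 0 - ∏ j, coeff a (h j) 1) / 2 - edgeTerm a h

theorem remainder_rev (a : ℝ → ℝ → ℂ) (m : ℕ) (h : ZeroSum p) :
    remainder a m (ZeroSum.rev h).1 =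
      ∑ i ∈ Finset.Ico (N h.1) (m - N (-h).1),
          ∏ j, coeff a (h.1 j) ((i + -midpoint h.1 j) / m) -
        m • ∫ x in (0 : ℝ)..1, ∏ j, coeff a (h.1 j) x := by
  have h_prod (x : ℝ) : ∏ j, coeff a ((ZeroSum.rev h).1 j) x = ∏ j, coeff a (h.1 j) x :=
    Equiv.prod_comp Fin.revPerm fun j => coeff a (h.1 j) x
  have h_shift (i : ℕ) : ∏ j, coeff a ((ZeroSum.rev h).1 j)
        ((i + midpoint (ZeroSum.rev h).1 j) / m) =
      ∏ j, coeff a (h.1 j) ((i + -midpoint h.1 j) / m) := by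
    rw [← Equiv.prod_comp Fin.revPerm]
    simp [ZeroSum.rev_apply, midpoint_rev]
  simp only [remainder, ← ZeroSum.coe_neg, N_neg_rev, N_rev, h_prod, h_shift]

theorem secondOrderTerm_add_rev (a : ℝ → ℝ → ℂ) (h : ZeroSum p) :
    secondOrderTerm a h.1 + secondOrderTerm a (ZeroSum.rev h).1 =
      ∏ j, coeff a (h.1 j) 0 - ∏ j, coeff a (h.1 j) 1 -
        (N (-h).1 + N h.1) • (∏ j, coeff a (h.1 j) 0 + ∏ j, coeff a (h.1 j) 1) := by
  have h_prod (x : ℝ) : ∏ j, coeff a ((ZeroSum.rev h).1 j) x = ∏ j, coeff a (h.1 j) x :=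
    Equiv.prod_comp Fin.revPerm fun j => coeff a (h.1 j) x
  simp only [secondOrderTerm, edgeTerm, h_prod, N_rev, nsmul_eq_mul, Nat.cast_add]
  ring

theorem tendsto_remainder_add_rev (ha : ∀ k, ContDiffOn ℝ 1 (coeff a k) (Icc 0 1))
    (h : ZeroSum p) :
    Tendsto (fun m => remainder a m h.1 + remainder a m (ZeroSum.rev h).1) atTop
      (𝓝 (secondOrderTerm a h.1 + secondOrderTerm a (ZeroSum.rev h).1)) := by
  simp only [remainder_rev, secondOrderTerm_add_rev]
  refine tendsto_symm_sum_Ico_prod_sub_integral (fun j => ha (h.1 j))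
    (fun m i hi => add_midpoint_div_mem_Icc h hi) fun m i hi j => ?_
  rw [← midpoint_rev]
  exact add_midpoint_div_mem_Icc (ZeroSum.rev h) (by rwa [N_neg_rev, N_rev]) _

/-- The weight of a step `k` whose product along a closed path dominates the remainders. -/
def weight (a : ℝ → ℝ → ℂ) (k : ℤ) : ℝ :=
  (1 + |(k : ℝ)|) * supNorm (coeff a k) + supNorm (derivWithin (coeff a k) (Icc 0 1))

theorem one_add_abs_mul_supNorm_le_weight (a : ℝ → ℝ → ℂ) (k : ℤ) :
    (1 + |(k : ℝ)|) * supNorm (coeff a k) ≤ weight a k :=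
  le_add_of_nonneg_right (supNorm_nonneg _)

theorem weight_nonneg (a : ℝ → ℝ → ℂ) (k : ℤ) : 0 ≤ weight a k :=
  (mul_nonneg (by positivity) (supNorm_nonneg _)).trans (one_add_abs_mul_supNorm_le_weight a k)

theorem supNorm_coeff_le_weight (a : ℝ → ℝ → ℂ) (k : ℤ) : supNorm (coeff a k) ≤ weight a k :=
  (le_mul_of_one_le_left (supNorm_nonneg _) (le_add_of_nonneg_right (abs_nonneg _))).trans
    (one_add_abs_mul_supNorm_le_weight a k)

theorem supNorm_derivWithin_coeff_le_weight (a : ℝ → ℝ → ℂ) (k : ℤ) :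
    supNorm (derivWithin (coeff a k) (Icc 0 1)) ≤ weight a k :=
  le_add_of_nonneg_left (mul_nonneg (by positivity) (supNorm_nonneg _))

theorem one_add_sum_le_prod_one_add {ι R : Type*} [CommSemiring R] [PartialOrder R]
    [IsOrderedRing R] (s : Finset ι) {x : ι → R} (hx : ∀ j, 0 ≤ x j) :
    1 + ∑ j ∈ s, x j ≤ ∏ j ∈ s, (1 + x j) := by
  classical
  induction s using Finset.induction_on with
  | empty => simp
  | insert i s hi ih =>
    have h_one : 1 ≤ ∏ j ∈ s, (1 + x j) :=
      Finset.one_le_prod fun j _ => le_add_of_nonneg_right (hx j)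
    rw [Finset.sum_insert hi, Finset.prod_insert hi, add_mul, one_mul, add_left_comm, add_comm]
    exact add_le_add ih (le_mul_of_one_le_right (hx i) h_one)

theorem one_add_sum_abs_mul_prod_supNorm_le {ι : Type*} (a : ℝ → ℝ → ℂ) (s : Finset ι)
    (h : ι → ℤ) :
    (1 + ∑ j ∈ s, |(h j : ℝ)|) * ∏ j ∈ s, supNorm (coeff a (h j)) ≤ ∏ j ∈ s, weight a (h j) :=
  calc (1 + ∑ j ∈ s, |(h j : ℝ)|) * ∏ j ∈ s, supNorm (coeff a (h j))
      ≤ (∏ j ∈ s, (1 + |(h j : ℝ)|)) * ∏ j ∈ s, supNorm (coeff a (h j)) :=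
        mul_le_mul_of_nonneg_right (one_add_sum_le_prod_one_add s fun _ => abs_nonneg _)
          (Finset.prod_nonneg fun _ _ => supNorm_nonneg _)
    _ = ∏ j ∈ s, (1 + |(h j : ℝ)|) * supNorm (coeff a (h j)) := Finset.prod_mul_distrib.symm
    _ ≤ ∏ j ∈ s, weight a (h j) :=
        Finset.prod_le_prod (fun _ _ => mul_nonneg (by positivity) (supNorm_nonneg _))
          fun j _ => one_add_abs_mul_supNorm_le_weight a (h j)

theorem mul_prod_supNorm_le {c : ℝ} {h : Fin p → ℤ} (hc : c ≤ ∑ j, |(h j : ℝ)|) :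
    c * ∏ j, supNorm (coeff a (h j)) ≤ ∏ j, weight a (h j) :=
  (mul_le_mul_of_nonneg_right (hc.trans (le_add_of_nonneg_left zero_le_one))
    (Finset.prod_nonneg fun _ _ => supNorm_nonneg _)).trans
    (one_add_sum_abs_mul_prod_supNorm_le a Finset.univ h)

theorem norm_edgeTerm_le (ha : ∀ k, ContinuousOn (coeff a k) (Icc 0 1)) (h : ZeroSum p) :
    ‖edgeTerm a h.1‖ ≤ 2 * ∏ j, weight a (h.1 j) := by
  have norm_prod_le {x : ℝ} (hx : x ∈ Icc (0 : ℝ) 1) :=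
    norm_prod_le_prod_supNorm (fun j => ha (h.1 j)) hx
  calc ‖edgeTerm a h.1‖
      = N h.1 * ‖∏ j, coeff a (h.1 j) 0 + ∏ j, coeff a (h.1 j) 1‖ := by simp [edgeTerm]
    _ ≤ N h.1 * (∏ j, supNorm (coeff a (h.1 j)) + ∏ j, supNorm (coeff a (h.1 j))) := by
        gcongr
        exact (norm_add_le _ _).trans (add_le_add (norm_prod_le (left_mem_Icc.2 zero_le_one))
          (norm_prod_le (right_mem_Icc.2 zero_le_one)))
    _ = 2 * (N h.1 * ∏ j, supNorm (coeff a (h.1 j))) := by ring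
    _ ≤ 2 * ∏ j, weight a (h.1 j) := by
        gcongr
        exact mul_prod_supNorm_le (mod_cast N_le_sum_abs h)

theorem norm_remainder_le (ha : ∀ k, ContDiffOn ℝ 1 (coeff a k) (Icc 0 1)) (m : ℕ)
    (h : ZeroSum p) : ‖remainder a m h.1‖ ≤ (p + 2) * ∏ j, weight a (h.1 j) := by
  have h_right : N h.1 * ∏ j, supNorm (coeff a (h.1 j)) ≤ ∏ j, weight a (h.1 j) :=
    mul_prod_supNorm_le (mod_cast N_le_sum_abs h)
  have h_left : N (-h).1 * ∏ j, supNorm (coeff a (h.1 j)) ≤ ∏ j, weight a (h.1 j) := by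
    have h_N := N_le_sum_abs (-h)
    simp only [ZeroSum.coe_neg, Pi.neg_apply, abs_neg] at h_N
    exact mul_prod_supNorm_le (mod_cast h_N)
  have h_factor (j : Fin p) : supNorm (derivWithin (coeff a (h.1 j)) (Icc 0 1)) *
      (1 + |midpoint h.1 j|) * ∏ l ∈ Finset.univ.erase j, supNorm (coeff a (h.1 l)) ≤
      ∏ j, weight a (h.1 j) := by
    rw [mul_assoc, ← Finset.mul_prod_erase _ _ (Finset.mem_univ j)]
    refine mul_le_mul (supNorm_derivWithin_coeff_le_weight a _) ?_ ?_ (weight_nonneg a _)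
    · refine le_trans (mul_le_mul_of_nonneg_right ?_
        (Finset.prod_nonneg fun _ _ => supNorm_nonneg _))
        (one_add_sum_abs_mul_prod_supNorm_le a _ h.1)
      gcongr
      exact abs_midpoint_le h j
    · exact mul_nonneg (by positivity) (Finset.prod_nonneg fun _ _ => supNorm_nonneg _)
  refine (norm_sum_Ico_prod_sub_nsmul_integral_le (fun j => ha (h.1 j))
    fun i hi => add_midpoint_div_mem_Icc h hi).trans ?_
  calc _ ≤ (∏ j, weight a (h.1 j) + ∏ j, weight a (h.1 j)) +
        ∑ _j : Fin p, ∏ j, weight a (h.1 j) := by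
        rw [add_mul]
        exact add_le_add (add_le_add h_left h_right) (Finset.sum_le_sum fun j _ => h_factor j)
    _ = (p + 2) * ∏ j, weight a (h.1 j) := by
        rw [Finset.sum_const, Finset.card_univ, Fintype.card_fin, nsmul_eq_mul]
        ring

end Symbol

section TraceError

variable {a : ℝ → ℝ → ℂ}

theorem hasSum_trace_T_pow (a : ℝ → ℝ → ℂ) (p n : ℕ) :
    HasSum (fun h : ZeroSum p => ∑ i ∈ Finset.Ico (N (-h).1) (n + 1 - N h.1),
        ∏ j, coeff a (h.1 j) ((i + midpoint h.1 j) / (n + 1 : ℕ)))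
      (T a n ^ p).trace := by
  have h_trace := hasSum_trace_pow
    (fun u v : ℤ => coeff a (v - u) ((u + v : ℝ) / (2 * n + 2))) (n + 1) p
  refine h_trace.congr_fun fun h => Finset.sum_congr rfl fun i _ =>
    Finset.prod_congr rfl fun j _ => ?_
  beta_reduce
  have h_step : i + Fin.partialSum h.1 j.succ - (i + Fin.partialSum h.1 j.castSucc) = h.1 j := by
    rw [Fin.partialSum_succ]
    ring
  rw [h_step, midpoint]
  congr 1
  push_cast
  field_simp
  ring

theorem hasSum_prod_coeff (hcoeff : ∀ k, ContinuousOn (coeff a k) (Icc 0 1))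
    (hsup : Summable fun k => supNorm (coeff a k))
    (ha : ∀ x ∈ Icc (0 : ℝ) 1, MemLp (a x) 2 (volume.restrict (Ioc 0 (2 * Real.pi)))) (p : ℕ)
    {x : ℝ} (hx : x ∈ Icc (0 : ℝ) 1) :
    HasSum (fun h : ZeroSum p => ∏ j, coeff a (h.1 j) x)
      (1 / (2 * Real.pi) * ∫ t in (0 : ℝ)..(2 * Real.pi), a x t ^ p) := by
  have h_summable : Summable fun k => ‖fourierCoeffOn Real.two_pi_pos (a x) k‖ :=
    hsup.of_nonneg_of_le (fun _ => norm_nonneg _) fun k => norm_le_supNorm (hcoeff k) hx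
  have h_sum := (hasSum_intervalIntegral_pow Real.two_pi_pos (ha x hx) h_summable p).mul_left
    (1 / (2 * Real.pi) : ℂ)
  refine h_sum.congr_fun fun h => ?_
  have h_pi : (Real.pi : ℂ) ≠ 0 := mod_cast Real.pi_ne_zero
  push_cast
  rw [sub_zero, ← mul_assoc, one_div_mul_cancel (mul_ne_zero two_ne_zero h_pi), one_mul]
  rfl

theorem hasSum_integral_prod_coeff (hcoeff : ∀ k, ContinuousOn (coeff a k) (Icc 0 1))
    (hsup : Summable fun k => supNorm (coeff a k))
    (ha : ∀ x ∈ Icc (0 : ℝ) 1, MemLp (a x) 2 (volume.restrict (Ioc 0 (2 * Real.pi)))) (p : ℕ) :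
    HasSum (fun h : ZeroSum p => ∫ x in (0 : ℝ)..1, ∏ j, coeff a (h.1 j) x)
      (1 / (2 * Real.pi) *
        ∫ x in (0 : ℝ)..1, ∫ t in (0 : ℝ)..(2 * Real.pi), a x t ^ p) := by
  rw [← intervalIntegral.integral_const_mul]
  have h_subset : uIoc (0 : ℝ) 1 ⊆ Icc 0 1 := uIoc_of_le (zero_le_one' ℝ) ▸ Ioc_subset_Icc_self
  have h_bound : Summable fun h : ZeroSum p => ∏ j, supNorm (coeff a (h.1 j)) :=
    (hasSum_prod_pow hsup.norm p).2.summable.comp_injective Subtype.val_injective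
  refine intervalIntegral.hasSum_integral_of_dominated_convergence
    (fun h _ => ∏ j, supNorm (coeff a (h.1 j))) (fun h => ?_) (fun h => ?_)
    (.of_forall fun _ _ => h_bound) intervalIntegrable_const
    (.of_forall fun x hx => hasSum_prod_coeff hcoeff hsup ha p (h_subset hx))
  · exact ContinuousOn.aestronglyMeasurable
      (continuousOn_finsetProd _ fun j _ => (hcoeff _).mono h_subset) measurableSet_uIoc
  · exact .of_forall fun x hx => norm_prod_le_prod_supNorm (fun _ => hcoeff _) (h_subset hx)

/-- The error of the second-order trace formula for `T_n(a)^p`: the left-hand side minus the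
explicit part of the right-hand side. -/
def traceError (a : ℝ → ℝ → ℂ) (p n : ℕ) : ℂ :=
  (T a n ^ p).trace -
    (((n : ℂ) + 1) / (2 * Real.pi) *
        (∫ x in (0 : ℝ)..1, ∫ t in (0 : ℝ)..(2 * Real.pi), a x t ^ p)
      + 1 / (4 * Real.pi) * (∫ t in (0 : ℝ)..(2 * Real.pi), a 0 t ^ p)
      - 1 / (4 * Real.pi) * (∫ t in (0 : ℝ)..(2 * Real.pi), a 1 t ^ p)
      - ∑' h : ZeroSum p, edgeTerm a h.1)

theorem summable_supNorm_coeff (hw : Summable (weight a)) :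
    Summable fun k => supNorm (coeff a k) :=
  hw.of_nonneg_of_le (fun _ => supNorm_nonneg _) (supNorm_coeff_le_weight a)

theorem summable_prod_weight (hw : Summable (weight a)) (p : ℕ) :
    Summable fun h : ZeroSum p => ∏ j, weight a (h.1 j) :=
  (hasSum_prod_pow hw.norm p).2.summable.comp_injective Subtype.val_injective

theorem summable_edgeTerm (hcoeff : ∀ k, ContinuousOn (coeff a k) (Icc 0 1))
    (hw : Summable (weight a)) (p : ℕ) : Summable fun h : ZeroSum p => edgeTerm a h.1 :=
  ((summable_prod_weight hw p).mul_left 2).of_norm_bounded (norm_edgeTerm_le hcoeff)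

theorem hasSum_traceError (hcoeff : ∀ k, ContinuousOn (coeff a k) (Icc 0 1))
    (hw : Summable (weight a))
    (ha : ∀ x ∈ Icc (0 : ℝ) 1, MemLp (a x) 2 (volume.restrict (Ioc 0 (2 * Real.pi))))
    (p n : ℕ) :
    HasSum (fun h : ZeroSum p => remainder a (n + 1) h.1 - secondOrderTerm a h.1)
      (traceError a p n) := by
  have hsup := summable_supNorm_coeff hw
  have h_bulk := (hasSum_integral_prod_coeff hcoeff hsup ha p).mul_left ((n : ℂ) + 1)
  have h_zero := hasSum_prod_coeff hcoeff hsup ha p (left_mem_Icc.2 zero_le_one)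
  have h_one := hasSum_prod_coeff hcoeff hsup ha p (right_mem_Icc.2 zero_le_one)
  have h_edge := (summable_edgeTerm hcoeff hw p).hasSum
  have h_sum : HasSum (fun h : ZeroSum p => remainder a (n + 1) h.1 - secondOrderTerm a h.1) _ :=
    (((hasSum_trace_T_pow a p n).sub h_bulk).sub
      (((h_zero.sub h_one).div_const 2).sub h_edge)).congr_fun fun h => by
        simp only [remainder, secondOrderTerm, nsmul_eq_mul, Nat.cast_succ, ← ZeroSum.coe_neg]
  have h_value : traceError a p n =
      ∑' h : ZeroSum p, (remainder a (n + 1) h.1 - secondOrderTerm a h.1) := by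
    rw [h_sum.tsum_eq, traceError]
    ring
  exact h_value ▸ h_sum.summable.hasSum

theorem tendsto_traceError (hcoeff : ∀ k, ContDiffOn ℝ 1 (coeff a k) (Icc 0 1))
    (hw : Summable (weight a))
    (ha : ∀ x ∈ Icc (0 : ℝ) 1, MemLp (a x) 2 (volume.restrict (Ioc 0 (2 * Real.pi))))
    (p : ℕ) : Tendsto (traceError a p) atTop (𝓝 0) := by
  have h_error (n : ℕ) := hasSum_traceError (fun k => (hcoeff k).continuousOn) hw ha p n
  set R : ℕ → ZeroSum p → ℂ := fun m h => remainder a m h.1 + remainder a m (ZeroSum.rev h).1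
  set S : ZeroSum p → ℂ := fun h => secondOrderTerm a h.1 + secondOrderTerm a (ZeroSum.rev h).1
  set B : ZeroSum p → ℝ := fun h => 2 * ((p + 2) * ∏ j, weight a (h.1 j))
  have h_symm (n : ℕ) : HasSum (fun h => R (n + 1) h - S h) (2 * traceError a p n) := by
    rw [two_mul]
    refine ((h_error n).add (ZeroSum.rev.hasSum_iff.2 (h_error n))).congr_fun fun h => ?_
    simp only [R, S, Function.comp_apply]
    ring
  have h_lim (h : ZeroSum p) : Tendsto (R · h) atTop (𝓝 (S h)) :=
    tendsto_remainder_add_rev hcoeff h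
  have h_bound (m : ℕ) (h : ZeroSum p) : ‖R m h‖ ≤ B h := by
    have h_prod : ∏ j, weight a ((ZeroSum.rev h).1 j) = ∏ j, weight a (h.1 j) :=
      Equiv.prod_comp Fin.revPerm fun j => weight a (h.1 j)
    have h_rev := norm_remainder_le hcoeff m (ZeroSum.rev h)
    rw [h_prod] at h_rev
    linarith [norm_add_le_of_le (norm_remainder_le hcoeff m h) h_rev]
  have h_tannery : Tendsto (fun n => ∑' h, (R (n + 1) h - S h)) atTop
      (𝓝 (∑' _ : ZeroSum p, 0)) := by
    refine tendsto_tsum_of_dominated_convergence (bound := fun h => B h + B h) ?_ (fun h => ?_)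
      (.of_forall fun n h => norm_sub_le_of_le (h_bound _ h)
        (le_of_tendsto' (h_lim h).norm fun m => h_bound m h))
    · have h_summable := ((summable_prod_weight hw p).mul_left ((p : ℝ) + 2)).mul_left 2
      exact h_summable.add h_summable
    · simpa using ((tendsto_add_atTop_iff_nat 1).2 (h_lim h)).sub_const (S h)
  simp only [fun n => (h_symm n).tsum_eq, tsum_zero] at h_tannery
  simpa using h_tannery.const_mul (2⁻¹ : ℂ)

theorem coeff_eq_zero_of_tripleNorm_eq_zero (hcoeff : ∀ k, ContinuousOn (coeff a k) (Icc 0 1))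
    (hsup : Summable fun k => supNorm (coeff a k)) (h_norm : tripleNorm a = 0) (k : ℤ) {x : ℝ}
    (hx : x ∈ Icc (0 : ℝ) 1) : coeff a k x = 0 := by
  have h_sum : HasSum (fun k => supNorm (coeff a k)) 0 := h_norm ▸ hsup.hasSum
  have h_zero := (hasSum_zero_iff_of_nonneg fun k => supNorm_nonneg (coeff a k)).1 h_sum
  exact norm_le_zero_iff.1 ((norm_le_supNorm (hcoeff k) hx).trans (congrFun h_zero k).le)

theorem traceError_eq_zero (hcoeff : ∀ k, ContinuousOn (coeff a k) (Icc 0 1))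
    (hw : Summable (weight a))
    (ha : ∀ x ∈ Icc (0 : ℝ) 1, MemLp (a x) 2 (volume.restrict (Ioc 0 (2 * Real.pi))))
    {p : ℕ} (hp : (p : ℂ) * (tripleNorm a : ℂ) ^ (p - 1) = 0) (n : ℕ) :
    traceError a p n = 0 := by
  refine (hasSum_traceError hcoeff hw ha p n).unique (hasSum_zero.congr_fun fun h => ?_)
  obtain rfl | hp₀ := eq_or_ne p 0
  · simp [remainder, secondOrderTerm, edgeTerm, N]
  have h_norm : tripleNorm a = 0 := by
    have h_pow := (mul_eq_zero.1 hp).resolve_left (Nat.cast_ne_zero.2 hp₀)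
    exact Complex.ofReal_eq_zero.1 (eq_zero_of_pow_eq_zero h_pow)
  have h_prod {x : Fin p → ℝ} (hx : ∀ j, x j ∈ Icc (0 : ℝ) 1) :
      ∏ j, coeff a (h.1 j) (x j) = 0 :=
    Finset.prod_eq_zero (Finset.mem_univ ⟨0, Nat.pos_of_ne_zero hp₀⟩)
      (coeff_eq_zero_of_tripleNorm_eq_zero hcoeff (summable_supNorm_coeff hw) h_norm _ (hx _))
  have h_integral : ∫ x in (0 : ℝ)..1, ∏ j, coeff a (h.1 j) x = 0 :=
    intervalIntegral.integral_zero_ae (.of_forall fun x hx => h_prod fun _ =>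
      (uIoc_of_le (zero_le_one' ℝ) ▸ Ioc_subset_Icc_self : uIoc (0 : ℝ) 1 ⊆ Icc 0 1) hx)
  have h_sum := Finset.sum_eq_zero fun i hi => h_prod (add_midpoint_div_mem_Icc h (m := n + 1) hi)
  rw [remainder, ← ZeroSum.coe_neg, h_sum, h_integral, secondOrderTerm, edgeTerm,
    h_prod fun _ => left_mem_Icc.2 zero_le_one, h_prod fun _ => right_mem_Icc.2 zero_le_one]
  simp

end TraceError

section Hypotheses

theorem memLp_restrict_Ioc_of_continuousOn_Icc {E : Type*} [NormedAddCommGroup E]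
    {f : ℝ → E} {u v : ℝ} (hf : ContinuousOn f (Icc u v)) (q : ENNReal) :
    MemLp f q (volume.restrict (Ioc u v)) := by
  obtain ⟨C, hC⟩ := isCompact_Icc.exists_bound_of_continuousOn hf
  exact .of_bound ((hf.mono Ioc_subset_Icc_self).aestronglyMeasurable measurableSet_Ioc) C
    (ae_restrict_of_forall_mem measurableSet_Ioc fun t ht => hC t (Ioc_subset_Icc_self ht))

theorem summable_abs_mul_of_rpow {A : ℤ → ℝ} (hA : ∀ k, 0 ≤ A k) {s : ℝ} (hs : 1 ≤ s)
    (h : Summable fun k : ℤ => |(k : ℝ)| ^ s * A k) : Summable fun k : ℤ => |(k : ℝ)| * A k := by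
  refine h.of_nonneg_of_le (fun k => mul_nonneg (abs_nonneg _) (hA k)) fun k => ?_
  refine mul_le_mul_of_nonneg_right ?_ (hA k)
  obtain rfl | hk := eq_or_ne k 0
  · simpa using Real.rpow_nonneg le_rfl s
  · exact Real.self_le_rpow_of_one_le (mod_cast Int.one_le_abs hk) hs

theorem summable_weight {a : ℝ → ℝ → ℂ}
    (hdecay : Summable fun k : ℤ => |(k : ℝ)| * supNorm (coeff a k))
    (hderiv : Summable fun k : ℤ => supNorm (derivWithin (coeff a k) (Icc 0 1))) :
    Summable (weight a) := by
  have hsup : Summable fun k => supNorm (coeff a k) := by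
    refine hdecay.of_norm_bounded_eventually ?_
    filter_upwards [(finite_singleton (0 : ℤ)).compl_mem_cofinite] with k hk
    rw [Real.norm_of_nonneg (supNorm_nonneg _)]
    exact le_mul_of_one_le_left (supNorm_nonneg _) (mod_cast Int.one_le_abs hk)
  exact ((hsup.add hdecay).add hderiv).congr fun k => by rw [weight, one_add_mul]

end Hypotheses

end KMS

end

theorem mainTheorem4_general (a : ℝ → ℝ → ℂ)
    (ha : ∀ x ∈ Icc (0 : ℝ) 1, MemLp (a x) 2 (volume.restrict (Ioc 0 (2 * Real.pi))))
    (hcoeff : ∀ k : ℤ, ContDiffOn ℝ 1 (KMS.coeff a k) (Icc 0 1))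
    (hdecay : Summable fun k : ℤ => |(k : ℝ)| * KMS.supNorm (KMS.coeff a k))
    (hdecay_deriv : Summable fun k : ℤ => KMS.supNorm (derivWithin (KMS.coeff a k) (Icc 0 1)))
    (p : ℕ) :
    Summable (fun h : {h : Fin p → ℤ // ∑ j, h j = 0} => KMS.edgeTerm a h.1) ∧
    ∃ η : ℕ → ℂ, Tendsto η atTop (𝓝 0) ∧ ∀ n : ℕ,
      (KMS.T a n ^ p).trace =
        ((n : ℂ) + 1) / (2 * Real.pi) *
            (∫ x in (0 : ℝ)..1, ∫ t in (0 : ℝ)..(2 * Real.pi), a x t ^ p)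
          + 1 / (4 * Real.pi) * (∫ t in (0 : ℝ)..(2 * Real.pi), a 0 t ^ p)
          - 1 / (4 * Real.pi) * (∫ t in (0 : ℝ)..(2 * Real.pi), a 1 t ^ p)
          - (∑' h : {h : Fin p → ℤ // ∑ j, h j = 0}, KMS.edgeTerm a h.1)
          + (p : ℂ) * (KMS.tripleNorm a : ℂ) ^ (p - 1) * η n := by
  have hcont (k : ℤ) := (hcoeff k).continuousOn
  have hw := KMS.summable_weight hdecay hdecay_deriv
  refine ⟨KMS.summable_edgeTerm hcont hw p,
    fun n => KMS.traceError a p n / ((p : ℂ) * (KMS.tripleNorm a : ℂ) ^ (p - 1)), ?_, fun n => ?_⟩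
  · simpa using (KMS.tendsto_traceError hcoeff hw ha p).div_const _
  · rw [mul_div_cancel_of_imp' fun hp => KMS.traceError_eq_zero hcont hw ha hp n, KMS.traceError,
      add_sub_cancel]

theorem mainTheorem4
    (a : ℝ → ℝ → ℂ) (α : ℝ≥0) (hα_pos : 0 < α) (hα_le : α ≤ 1)
    (ha_t : ∀ x ∈ Icc (0 : ℝ) 1, KMS.C1Holder α (fun t => a x t) 0 (2 * Real.pi))
    (ha_x : ∀ t ∈ Icc (0 : ℝ) (2 * Real.pi), KMS.C1Holder α (fun x => a x t) 0 1)
    (hcoeff : ∀ k : ℤ, ContDiffOn ℝ 1 (KMS.coeff a k) (Icc 0 1))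
    (hdecay : Summable fun k : ℤ =>
      |(k : ℝ)| ^ (1 + 1 / (α : ℝ)) * KMS.supNorm (KMS.coeff a k))
    (hdecay_deriv : Summable fun k : ℤ =>
      KMS.supNorm (derivWithin (KMS.coeff a k) (Icc 0 1)))
    (p : ℕ) :
    Summable (fun h : {h : Fin p → ℤ // ∑ j, h j = 0} => KMS.edgeTerm a h.1) ∧
    ∃ η : ℕ → ℂ, Tendsto η atTop (𝓝 0) ∧ ∀ n : ℕ,
      (KMS.T a n ^ p).trace =
        ((n : ℂ) + 1) / (2 * Real.pi) *
            (∫ x in (0 : ℝ)..1, ∫ t in (0 : ℝ)..(2 * Real.pi), a x t ^ p)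
          + 1 / (4 * Real.pi) * (∫ t in (0 : ℝ)..(2 * Real.pi), a 0 t ^ p)
          - 1 / (4 * Real.pi) * (∫ t in (0 : ℝ)..(2 * Real.pi), a 1 t ^ p)
          - (∑' h : {h : Fin p → ℤ // ∑ j, h j = 0}, KMS.edgeTerm a h.1)
          + (p : ℂ) * (KMS.tripleNorm a : ℂ) ^ (p - 1) * η n :=
  mainTheorem4_general a
    (fun x hx => KMS.memLp_restrict_Ioc_of_continuousOn_Icc (ha_t x hx).1.continuousOn 2) hcoeff
    (KMS.summable_abs_mul_of_rpow (fun _ => KMS.supNorm_nonneg _)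
      (le_add_of_nonneg_right (by positivity)) hdecay) hdecay_deriv p
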